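/- Let $\Gamma$ be a finite simplicial graph with vertex set $V$, and let $A_\Gamma$ be the right-angled Artin group generated by $V$ with relations $[v,w]=1$ for adjacent $v,w$. For $\Delta\subseteq V$, let $A_\Delta=\langle\Delta\rangle\le A_\Gamma$ be the corresponding special subgroup. An outer automorphism $\Phi$ of $A_\Gamma$ stabilises (resp. acts trivially on) a subgroup $B$ if some representative $\varphi$ of $\Phi$ satisfies $\varphi(B)=B$ (resp. $\varphi|_B=\mathrm{id}$). Write $\mathrm{lk}(v)$ for the set of vertices adjacent to $v$, and $\mathrm{st}(v)=\{v\}\cup\mathrm{lk}(v)$. Let $\mathrm{Out}^0(A_\Gamma)\le\mathrm{Out}(A_\Gamma)$ be the subgroup generated by all inversions $v\mapsto v^{-1}$, all transvections $v\mapsto vw$ with $v\neq w$ and $\mathrm{lk}(v)\subseteq\mathrm{st}(w)$, and all partial conjugations $x\mapsto vxv^{-1}$ $(x\in K)$, where $K$ is a union of connected components of $\Gamma\setminus\mathrm{st}(v)$ (in each case the remaining vertices are fixed). For families $\mathcal G,\mathcal H$ of special subgroups, let $\mathrm{Out}^0(A_\Gamma;\mathcal G,\mathcal H^t)$ be the group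 of all elements of $\mathrm{Out}^0(A_\Gamma)$ that stabilise every member of $\mathcal G$ and act trivially on every member of $\mathcal H$; groups of this form are called relative automorphism groups of $A_\Gamma$. The family $\mathcal G$ is saturated with respect to $(\mathcal G,\mathcal H)$ if it contains every proper special subgroup stabilised by $\mathrm{Out}^0(A_\Gamma;\mathcal G,\mathcal H^t)$. Write $v\le_{\mathcal G}w$ if $\mathrm{lk}(v)\subseteq\mathrm{st}(w)$ and every $A_\Delta\in\mathcal G$ with $v\in\Delta$ has $w\in\Delta$; this is a preorder. Let $\sim_{\mathcal G}$ be the induced equivalence relation and $T_{\mathcal G}$ the set of its classes. For $\mathcal G$ saturated with respect to $(\mathcal G,\mathcal H)$, the rank of $\mathrm{Out}^0(A_\Gamma;\mathcal G,\mathcal H^t)$ is $$\sum_{c\in T_{\mathcal G}}(|c|-1)=|V|-|T_{\mathcal G}|.$$ For a relative automorphism group $P$, the equation $\mathrm{rk}(P)=m$ means that $P=\mathrm{Out}^0(A_\Gamma;\mathcal G',\mathcal H'^t)$ for some $\mathcal G',\mathcal H'$ with $\mathcal G'$ saturated with respect to $(\mathcal G',\mathcal H')$, and that $|V|-|T_{\mathcal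 G'}|=m$ for every such pair. Let $O=\mathrm{Out}^0(A_\Gamma;\mathcal G,\mathcal H^t)$ with $\mathcal G$ saturated with respect to $(\mathcal G,\mathcal H)$, and let $r=\mathrm{rk}(O)=|V|-|T_{\mathcal G}|$. Fix an ordering $c=\{v_1,\dots,v_n\}$ of each class $c\in T_{\mathcal G}$. For $1\le j\le n-1$ put $$\Delta_c^j=\{v_1,\dots,v_j\}\cup\{w\in V: v_1\le_{\mathcal G}w,\ w\not\sim_{\mathcal G}v_1\}.$$ The set $\mathcal P(O)$ of maximal standard parabolic subgroups consists of all stabilisers $\mathrm{Stab}_O(A_{\Delta_c^j})$ with $c\in T_{\mathcal G}$ and $1\le j\le|c|-1$. For $1\le m\le r-1$, the set $\mathcal P_m(O)$ of rank-$m$ standard parabolic subgroups consists of all intersections of $r-m$ distinct elements of $\mathcal P(O)$. **Proposition (rank of parabolic subgroups).** For all $1\le m\le r-1$, every $P\in\mathcal P_m(O)$ is a relative automorphism group of $A_\Gamma$, and $\mathrm{rk}(P)=m$. Moreover, every $P\in\mathcal P(O)$ is a relative automorphism group of $A_\Gamma$, and $r\ge1$ and $\mathrm{rk}(P)=r-1$.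 -/

import Mathlib

namespace RAAG

universe u

/-! ### Outer automorphisms -/

section Outer

variable (A : Type u) [Group A]

/-- The group of inner automorphisms, as a subgroup of `Aut(A)`. -/
abbrev Inn : Subgroup (MulAut A) := (MulAut.conj : A →* MulAut A).range

instance inn_normal : (Inn A).Normal where
  conj_mem := by
    rintro _ ⟨a, rfl⟩ φ
    refine ⟨φ a, ?_⟩
    ext x
    simp [MulAut.conj_apply]

/-- The outer automorphism group `Out(A) = Aut(A) / Inn(A)`. -/
abbrev Out : Type u := MulAut A ⧸ Inn A

variable {A}

/-- The outer automorphism `[φ]` represented by `φ`. -/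
abbrev outMk (φ : MulAut A) : Out A := QuotientGroup.mk φ

/-- `Φ` stabilises `B ≤ A` if some representative `φ` of `Φ` satisfies `φ(B) = B`. -/
def Stabilises (Φ : Out A) (B : Subgroup A) : Prop :=
  ∃ φ : MulAut A, outMk φ = Φ ∧ B.map φ.toMonoidHom = B

/-- `Φ` acts trivially on `B ≤ A` if some representative of `Φ` restricts to the identity on `B`. -/
def ActsTrivially (Φ : Out A) (B : Subgroup A) : Prop :=
  ∃ φ : MulAut A, outMk φ = Φ ∧ ∀ b ∈ B, φ b = b

/-- The subgroup of `Out(A)` of all outer automorphisms that stabilise `B`. -/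
def stabOut (B : Subgroup A) : Subgroup (Out A) where
  carrier := {Φ | Stabilises Φ B}
  one_mem' := ⟨1, rfl, by ext x; simp [Subgroup.mem_map]⟩
  mul_mem' := by
    rintro _ _ ⟨φ, rfl, hφ⟩ ⟨ψ, rfl, hψ⟩
    refine ⟨φ * ψ, rfl, ?_⟩
    have h : (φ * ψ).toMonoidHom = φ.toMonoidHom.comp ψ.toMonoidHom := rfl
    rw [h, ← Subgroup.map_map, hψ, hφ]
  inv_mem' := by
    rintro _ ⟨φ, rfl, hφ⟩
    refine ⟨φ⁻¹, rfl, ?_⟩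
    have h : (φ⁻¹).toMonoidHom.comp φ.toMonoidHom = MonoidHom.id A := by
      ext x
      exact φ.symm_apply_apply x
    calc B.map (φ⁻¹).toMonoidHom = (B.map φ.toMonoidHom).map (φ⁻¹).toMonoidHom := by rw [hφ]
      _ = B := by rw [Subgroup.map_map, h, Subgroup.map_id]

/-- The subgroup of `Out(A)` of all outer automorphisms that act trivially on `B`. -/
def trivOut (B : Subgroup A) : Subgroup (Out A) where
  carrier := {Φ | ActsTrivially Φ B}
  one_mem' := ⟨1, rfl, fun _ _ => rfl⟩
  mul_mem' := by
    rintro _ _ ⟨φ, rfl, hφ⟩ ⟨ψ, rfl, hψ⟩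
    refine ⟨φ * ψ, rfl, fun b hb => ?_⟩
    rw [MulAut.mul_apply, hψ b hb, hφ b hb]
  inv_mem' := by
    rintro _ ⟨φ, rfl, hφ⟩
    refine ⟨φ⁻¹, rfl, fun b hb => ?_⟩
    conv_lhs => rw [← hφ b hb]
    exact φ.symm_apply_apply b

end Outer

/-! ### Right-angled Artin groups and `Out⁰` -/

section Artin

variable {V : Type u} (Γ : SimpleGraph V)

/-- The defining relators `[v, w]` of `A_Γ`, one for each pair of adjacent vertices. -/
def relators : Set (FreeGroup V) :=
  {r | ∃ v w : V, Γ.Adj v w ∧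
    r = FreeGroup.of v * FreeGroup.of w * (FreeGroup.of v)⁻¹ * (FreeGroup.of w)⁻¹}

/-- The right-angled Artin group `A_Γ`. -/
abbrev Artin : Type u := PresentedGroup (relators Γ)

/-- The generator of `A_Γ` given by a vertex. -/
abbrev gen (v : V) : Artin Γ := PresentedGroup.of v

/-- The special subgroup `A_Δ ≤ A_Γ` of a full subgraph, i.e. of a set `Δ` of vertices. -/
def special (Δ : Set V) : Subgroup (Artin Γ) := Subgroup.closure (gen Γ '' Δ)

/-- The link of a vertex. -/
def lk (v : V) : Set V := {w | Γ.Adj v w}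

/-- The star of a vertex. -/
def st (v : V) : Set V := insert v (lk Γ v)

/-- `φ` is the inversion `ι_v`. -/
def IsInversion (φ : MulAut (Artin Γ)) (v : V) : Prop :=
  φ (gen Γ v) = (gen Γ v)⁻¹ ∧ ∀ x, x ≠ v → φ (gen Γ x) = gen Γ x

/-- `φ` is the transvection `ρ_v^w`, where `v ≠ w` and `lk(v) ⊆ st(w)`. -/
def IsTransvection (φ : MulAut (Artin Γ)) (v w : V) : Prop :=
  v ≠ w ∧ lk Γ v ⊆ st Γ w ∧ φ (gen Γ v) = gen Γ v * gen Γ w ∧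
    ∀ x, x ≠ v → φ (gen Γ x) = gen Γ x

/-- `K` is a union of connected components of `Γ \ st(v)`. -/
def IsComponentUnion (v : V) (K : Set V) : Prop :=
  ∃ S : Set (Γ.induce (st Γ v)ᶜ).ConnectedComponent, K = Subtype.val '' (⋃ C ∈ S, C.supp)

/-- `φ` is the partial conjugation `π_K^v`, where `K` is a union of components of `Γ \ st(v)`. -/
def IsPartialConj (φ : MulAut (Artin Γ)) (v : V) (K : Set V) : Prop :=
  IsComponentUnion Γ v K ∧ (∀ x ∈ K, φ (gen Γ x) = gen Γ v * gen Γ x * (gen Γ v)⁻¹) ∧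
    ∀ x, x ∉ K → φ (gen Γ x) = gen Γ x

/-- The pure outer automorphism group `Out⁰(A_Γ)`, generated by all inversions, transvections and
partial conjugations. -/
def pureOut : Subgroup (Out (Artin Γ)) :=
  Subgroup.closure {Φ | ∃ φ : MulAut (Artin Γ), outMk φ = Φ ∧
    ((∃ v, IsInversion Γ φ v) ∨ (∃ v w, IsTransvection Γ φ v w) ∨ ∃ v K, IsPartialConj Γ φ v K)}

/-! ### Relative outer automorphism groups

A family of special subgroups of `A_Γ` is given by the set `𝒢 : Set (Set V)` of the vertex sets `Δ`
of its members `A_Δ` (distinct `Δ` have distinct `A_Δ`). -/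

/-- `Out⁰(A_Γ; 𝒢, ℋᵗ)`: the elements of `Out⁰(A_Γ)` that stabilise every member of `𝒢` and act
trivially on every member of `ℋ`. -/
def relOut (𝒢 ℋ : Set (Set V)) : Subgroup (Out (Artin Γ)) :=
  pureOut Γ ⊓ (⨅ Δ ∈ 𝒢, stabOut (special Γ Δ)) ⊓ (⨅ Δ ∈ ℋ, trivOut (special Γ Δ))

/-- `P` is a relative automorphism group of `A_Γ`. -/
def IsRelOut (P : Subgroup (Out (Artin Γ))) : Prop :=
  ∃ 𝒢 ℋ : Set (Set V), P = relOut Γ 𝒢 ℋ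

/-- `𝒢` is saturated with respect to `(𝒢, ℋ)`: it contains every proper special subgroup that is
stabilised by all of `Out⁰(A_Γ; 𝒢, ℋᵗ)`. -/
def Saturated (𝒢 ℋ : Set (Set V)) : Prop :=
  ∀ Δ : Set V, Δ ≠ Set.univ → (∀ Φ ∈ relOut Γ 𝒢 ℋ, Stabilises Φ (special Γ Δ)) → Δ ∈ 𝒢

/-- The stabiliser `Stab_O(A_Δ)`. -/
def stabIn (O : Subgroup (Out (Artin Γ))) (Δ : Set V) : Subgroup (Out (Artin Γ)) :=
  O ⊓ stabOut (special Γ Δ)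

/-! ### The `𝒢`-ordering and the rank -/

/-- The `𝒢`-ordering: `v ≤_𝒢 w` iff `lk(v) ⊆ st(w)` and every member of `𝒢` that contains `v` also
contains `w`. -/
def GLe (𝒢 : Set (Set V)) (v w : V) : Prop :=
  lk Γ v ⊆ st Γ w ∧ ∀ Δ ∈ 𝒢, v ∈ Δ → w ∈ Δ

theorem GLe.rfl' (𝒢 : Set (Set V)) (v : V) : GLe Γ 𝒢 v v :=
  ⟨Set.subset_insert _ _, fun _ _ h => h⟩

theorem GLe.trans' {𝒢 : Set (Set V)} {u v w : V} (h₁ : GLe Γ 𝒢 u v) (h₂ : GLe Γ 𝒢 v w) :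
    GLe Γ 𝒢 u w := by
  refine ⟨fun x hx => ?_, fun Δ hΔ h => h₂.2 Δ hΔ (h₁.2 Δ hΔ h)⟩
  rcases h₁.1 hx with rfl | hv
  · rcases h₂.1 (SimpleGraph.Adj.symm hx : Γ.Adj x u) with rfl | hw
    · exact Or.inr (hx)
    · rcases h₁.1 (SimpleGraph.Adj.symm hw : Γ.Adj u w) with rfl | hw'
      · exact Or.inl rfl
      · exact Or.inr (SimpleGraph.Adj.symm hw')
  · exact h₂.1 hv

/-- The equivalence relation `∼_𝒢` of the `𝒢`-ordering. -/
def gSetoid (𝒢 : Set (Set V)) : Setoid V where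
  r v w := GLe Γ 𝒢 v w ∧ GLe Γ 𝒢 w v
  iseqv :=
    { refl := fun v => ⟨GLe.rfl' Γ 𝒢 v, GLe.rfl' Γ 𝒢 v⟩
      symm := fun h => ⟨h.2, h.1⟩
      trans := fun h₁ h₂ => ⟨GLe.trans' Γ h₁.1 h₂.1, GLe.trans' Γ h₂.2 h₁.2⟩ }

/-- The set `T_𝒢` of `𝒢`-equivalence classes of vertices. -/
abbrev Classes (𝒢 : Set (Set V)) : Type u := Quotient (gSetoid Γ 𝒢)

/-- The vertices of a `𝒢`-equivalence class. -/
def classSet (𝒢 : Set (Set V)) (c : Classes Γ 𝒢) : Set V :=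
  {v | (Quotient.mk (gSetoid Γ 𝒢) v) = c}

/-- The number `∑_{c ∈ T_𝒢} (|c| - 1) = |V(Γ)| - |T_𝒢|` (never truncated, as `T_𝒢` is a quotient
of `V(Γ)`). It is the rank of `Out⁰(A_Γ; 𝒢, ℋᵗ)` if `𝒢` is saturated with respect to `(𝒢, ℋ)`. -/
noncomputable def rank (𝒢 : Set (Set V)) : ℕ := Nat.card V - Nat.card (Classes Γ 𝒢)

/-- `rk(P) = m`: the group `P` can be written as `Out⁰(A_Γ; 𝒢, ℋᵗ)` with `𝒢` saturated with respect
to `(𝒢, ℋ)`, and the rank computed from any such way of writing `P` is `m`. -/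
def HasRank (P : Subgroup (Out (Artin Γ))) (m : ℕ) : Prop :=
  (∃ 𝒢 ℋ : Set (Set V), Saturated Γ 𝒢 ℋ ∧ P = relOut Γ 𝒢 ℋ) ∧
    ∀ 𝒢 ℋ : Set (Set V), Saturated Γ 𝒢 ℋ → P = relOut Γ 𝒢 ℋ → rank Γ 𝒢 = m

/-! ### Standard parabolic subgroups -/

/-- The set `Γ_{≻ v}` of the vertices `w` with `v ≤_𝒢 w` and not `w ∼_𝒢 v`. -/
def above (𝒢 : Set (Set V)) (v : V) : Set V := {w | GLe Γ 𝒢 v w ∧ ¬ GLe Γ 𝒢 w v}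

/-- An ordering `c = {v_1, …, v_n}` of each `𝒢`-equivalence class `c`; here `v_{i+1}` is
the value at `i : Fin n`. -/
abbrev ClassOrdering (𝒢 : Set (Set V)) : Type u :=
  ∀ c : Classes Γ 𝒢, Fin (Nat.card (classSet Γ 𝒢 c)) ≃ classSet Γ 𝒢 c

/-- The vertex set `Δ_c^j = {v_1, …, v_j} ∪ Γ_{≻ c}`. -/
def parabolicSet (𝒢 : Set (Set V)) (e : ClassOrdering Γ 𝒢) (c : Classes Γ 𝒢) (j : ℕ) : Set V :=
  {x | ∃ i, i.val < j ∧ x = (e c i : V)} ∪ {x | ∃ v ∈ classSet Γ 𝒢 c, x ∈ above Γ 𝒢 v}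

/-- The set `𝒫(O)` of maximal standard parabolic subgroups `Stab_O(A_{Δ_c^j})`, `1 ≤ j ≤ |c| - 1`,
of `O = Out⁰(A_Γ; 𝒢, ℋᵗ)`. -/
def maxParabolics (𝒢 ℋ : Set (Set V)) (e : ClassOrdering Γ 𝒢) : Set (Subgroup (Out (Artin Γ))) :=
  {P | ∃ (c : Classes Γ 𝒢) (j : ℕ), 1 ≤ j ∧ j < Nat.card (classSet Γ 𝒢 c) ∧
    P = stabIn Γ (relOut Γ 𝒢 ℋ) (parabolicSet Γ 𝒢 e c j)}

/-- The set `𝒫_m(O)` of rank-`m` standard parabolic subgroups (`1 ≤ m ≤ rk(O) - 1`): all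
intersections of `rk(O) - m` distinct maximal standard parabolic subgroups of `O`. -/
def parabolics (𝒢 ℋ : Set (Set V)) (e : ClassOrdering Γ 𝒢) (m : ℕ) :
    Set (Subgroup (Out (Artin Γ))) :=
  {P | ∃ Q : Fin (rank Γ 𝒢 - m) → Subgroup (Out (Artin Γ)), Function.Injective Q ∧
    (∀ i, Q i ∈ maxParabolics Γ 𝒢 ℋ e) ∧ P = ⨅ i, Q i}

end Artin

end RAAG

/-!
For a saturated family `𝒢` the relation `v ≤_𝒢 w` can be read off from the group `P` that `𝒢`
defines: it says that `lk(v) ⊆ st(w)` and that every special subgroup stabilised by `P` that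
contains `v` contains `w`. If `𝒢` is enlarged to an arbitrary family `𝒢₁`, the relation read off
from the smaller group is still `≤_𝒢₁`: for `v ≤_𝒢₁ w` the transvection `v ↦ v w` belongs to that
group, and, as the exponent sum of `w` shows, it stabilises no `A_Δ` with `v ∈ Δ` and `w ∉ Δ`.
Hence the rank of the smaller group can be computed from `𝒢₁`, even though `𝒢₁` need not be
saturated. Adjoining `Δ_c^j` cuts the class `c` after its `j`-th vertex and no other class,
because `Δ_c^j` is closed upwards outside `c`; so `k` distinct cuts create exactly `k` new
classes.
-/

namespace RAAG

section Counting

theorem card_quotient_ker_inter_Iic {α P : Type*} [PartialOrder P] {loc : α → P} {C : Set P}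
    (hC : C ⊆ Set.range loc) (hmax : ∀ a, ∃ x, IsGreatest (C ∩ Set.Iic (loc a)) x) :
    Nat.card (Quotient (Setoid.ker fun a => C ∩ Set.Iic (loc a))) = C.ncard := by
  have hrange : Set.range (fun a => C ∩ Set.Iic (loc a)) = (fun x => C ∩ Set.Iic x) '' C := by
    ext S
    constructor
    · rintro ⟨a, rfl⟩
      obtain ⟨x, hx, hle⟩ := hmax a
      refine ⟨x, hx.1, Set.ext fun y => and_congr_right fun hy => ?_⟩
      exact ⟨fun h => le_trans h hx.2, fun h => hle ⟨hy, h⟩⟩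
    · rintro ⟨x, hx, rfl⟩
      obtain ⟨a, rfl⟩ := hC hx
      exact ⟨a, rfl⟩
  have hinj : Set.InjOn (fun x => C ∩ Set.Iic x) C := fun x hx y hy h =>
    le_antisymm (h.le ⟨hx, le_rfl⟩).2 (h.ge ⟨hy, le_rfl⟩).2
  rw [Nat.card_congr (Setoid.quotientKerEquivRange _), hrange, Nat.card_coe_set_eq,
    hinj.ncard_image]

/-- The first elements of the blocks into which the disjoint sum `Σ _ : β, ℕ` of chains falls when
it is cut before each element of the family `s`; the first block of every chain starts at `0`. -/
def blockStarts {ι β : Type*} (s : ι → Σ _ : β, ℕ) : Set (Σ _ : β, ℕ) :=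
  Set.range (fun b => ⟨b, 0⟩) ∪ Set.range s

theorem exists_isGreatest_blockStarts_inter_Iic {ι β : Type*} (s : ι → Σ _ : β, ℕ)
    (x : Σ _ : β, ℕ) : ∃ y, IsGreatest (blockStarts s ∩ Set.Iic x) y := by
  obtain ⟨b, n⟩ := x
  let K : Set ℕ := {k | ⟨b, k⟩ ∈ blockStarts s ∧ k ≤ n}
  have hbdd : BddAbove K := ⟨n, fun _ hk => hk.2⟩
  have hmem : sSup K ∈ K := Nat.sSup_mem ⟨0, .inl ⟨b, rfl⟩, n.zero_le⟩ hbdd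
  refine ⟨⟨b, sSup K⟩, ⟨hmem.1, Sigma.mk_le_mk_iff.2 hmem.2⟩, ?_⟩
  rintro _ ⟨hy, ⟨_, k, _, hk⟩⟩
  exact Sigma.mk_le_mk_iff.2 (le_csSup hbdd ⟨hy, hk⟩)

theorem ncard_blockStarts {ι β : Type*} [Finite ι] [Finite β] {s : ι → Σ _ : β, ℕ}
    (hs : Function.Injective s) (hpos : ∀ i, 0 < (s i).2) :
    (blockStarts s).ncard = Nat.card β + Nat.card ι := by
  have hdisj : Disjoint (Set.range fun b : β => (⟨b, 0⟩ : Σ _ : β, ℕ)) (Set.range s) := by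
    rw [Set.disjoint_left]
    rintro _ ⟨b, rfl⟩ ⟨i, hi⟩
    exact (hpos i).ne' (congrArg Sigma.snd hi)
  have hzero : Function.Injective fun b : β => (⟨b, 0⟩ : Σ _ : β, ℕ) :=
    fun _ _ h => congrArg Sigma.fst h
  rw [blockStarts, Set.ncard_union_eq hdisj, ← Nat.card_coe_set_eq, ← Nat.card_coe_set_eq,
    Nat.card_range_of_injective hzero, Nat.card_range_of_injective hs]

end Counting

section Outer

variable {A : Type*} [Group A]

theorem Stabilises.map_eq_one {G : Type*} [CommGroup G] {φ : MulAut A} {B : Subgroup A}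
    (h : Stabilises (outMk φ) B) {f : A →* G} (hf : B ≤ f.ker) {b : A} (hb : b ∈ B) :
    f (φ b) = 1 := by
  obtain ⟨ψ, hψ, hmap⟩ := h
  obtain ⟨g, hg⟩ := QuotientGroup.eq.1 hψ
  have hφ : φ = ψ * MulAut.conj g := by rw [hg, mul_inv_cancel_left]
  have hψb : f (ψ b) = 1 := hf (hmap.le ⟨b, hb, rfl⟩)
  rw [hφ, MulAut.mul_apply, MulAut.conj_apply, map_mul, map_mul, map_inv, map_mul, map_mul,
    map_inv, mul_inv_cancel_comm, hψb]

theorem ActsTrivially.stabilises {Φ : Out A} {B C : Subgroup A} (h : ActsTrivially Φ C)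
    (hBC : B ≤ C) : Stabilises Φ B := by
  obtain ⟨φ, hφ, hC⟩ := h
  refine ⟨φ, hφ, SetLike.coe_injective ?_⟩
  exact (Set.EqOn.image_eq fun b hb => hC b (hBC hb)).trans (Set.image_id _)

end Outer

variable {V : Type*} {Γ : SimpleGraph V}

section Generators

theorem commute_gen {x y : V} (h : Γ.Adj x y) : Commute (gen Γ x) (gen Γ y) := by
  have hrel := PresentedGroup.one_of_mem (rels := relators Γ) ⟨x, y, h, rfl⟩
  simp only [map_mul, map_inv] at hrel
  exact mul_inv_eq_iff_eq_mul.1 (mul_inv_eq_one.1 hrel)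

theorem commute_gen_of_mem_st {x y : V} (h : y ∈ st Γ x) : Commute (gen Γ x) (gen Γ y) := by
  rcases h with rfl | h
  · exact Commute.refl _
  · exact commute_gen h

theorem gen_mem_special {Δ : Set V} {x : V} (h : x ∈ Δ) : gen Γ x ∈ special Γ Δ :=
  Subgroup.subset_closure ⟨x, h, rfl⟩

theorem special_le_iff {Δ : Set V} {B : Subgroup (Artin Γ)} :
    special Γ Δ ≤ B ↔ ∀ x ∈ Δ, gen Γ x ∈ B :=
  (Subgroup.closure_le B).trans Set.image_subset_iff

/-- The homomorphism out of `A_Γ` with prescribed values on the vertices, given that the values at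
adjacent vertices commute. -/
def liftHom {G : Type*} [Group G] (f : V → G) (hf : ∀ x y, Γ.Adj x y → Commute (f x) (f y)) :
    Artin Γ →* G :=
  PresentedGroup.toGroup (f := f) <| by
    rintro _ ⟨x, y, h, rfl⟩
    simp [(hf x y h).eq]

@[simp] theorem liftHom_gen {G : Type*} [Group G] (f : V → G)
    (hf : ∀ x y, Γ.Adj x y → Commute (f x) (f y)) (x : V) : liftHom f hf (gen Γ x) = f x :=
  PresentedGroup.toGroup.of _

open Classical in
/-- The total exponent of the vertex `w` in an element of `A_Γ`, with `ℤ` written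
multiplicatively. -/
noncomputable def exponentSum (w : V) : Artin Γ →* Multiplicative ℤ :=
  liftHom (Pi.mulSingle w (Multiplicative.ofAdd 1)) fun _ _ _ => Commute.all _ _

theorem exponentSum_gen_self (w : V) : exponentSum w (gen Γ w) = Multiplicative.ofAdd 1 := by
  simp [exponentSum]

theorem exponentSum_gen_of_ne {x w : V} (h : x ≠ w) : exponentSum w (gen Γ x) = 1 := by
  simp [exponentSum, h]

theorem special_le_ker_exponentSum {Δ : Set V} {w : V} (hw : w ∉ Δ) :
    special Γ Δ ≤ (exponentSum w).ker :=
  special_le_iff.2 fun _ hx => exponentSum_gen_of_ne (ne_of_mem_of_not_mem hx hw)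

end Generators

section Transvections

variable {v w : V}

open Classical in
/-- The endomorphism `v ↦ v wⁿ` of `A_Γ` fixing all other vertices. -/
noncomputable def transvectionHom (h : lk Γ v ⊆ st Γ w) (n : ℤ) : Artin Γ →* Artin Γ :=
  liftHom (Function.update (gen Γ) v (gen Γ v * gen Γ w ^ n)) <| by
    have hcomm : ∀ y, Γ.Adj v y → Commute (gen Γ v * gen Γ w ^ n) (gen Γ y) := fun y hy =>
      (commute_gen hy).mul_left ((commute_gen_of_mem_st (h hy)).zpow_left n)
    intro x y hxy
    rcases eq_or_ne x v with rfl | hx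
    · simpa [hxy.ne'] using hcomm y hxy
    · rcases eq_or_ne y v with rfl | hy
      · simpa [hx] using (hcomm x hxy.symm).symm
      · simpa [hx, hy] using commute_gen hxy

theorem transvectionHom_gen_self (h : lk Γ v ⊆ st Γ w) (n : ℤ) :
    transvectionHom h n (gen Γ v) = gen Γ v * gen Γ w ^ n := by
  simp [transvectionHom]

theorem transvectionHom_gen_of_ne {x : V} (h : lk Γ v ⊆ st Γ w) (n : ℤ) (hx : x ≠ v) :
    transvectionHom h n (gen Γ x) = gen Γ x := by
  simp [transvectionHom, hx]

theorem transvectionHom_comp_eq_id (h : lk Γ v ⊆ st Γ w) (hvw : v ≠ w) {m n : ℤ}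
    (hmn : m + n = 0) :
    (transvectionHom h m).comp (transvectionHom h n) = MonoidHom.id (Artin Γ) := by
  refine PresentedGroup.ext fun x => ?_
  rw [MonoidHom.comp_apply, MonoidHom.id_apply]
  rcases eq_or_ne x v with rfl | hx
  · rw [transvectionHom_gen_self, map_mul, map_zpow, transvectionHom_gen_self,
      transvectionHom_gen_of_ne h m hvw.symm, mul_assoc, ← zpow_add, hmn, zpow_zero, mul_one]
  · rw [transvectionHom_gen_of_ne h n hx, transvectionHom_gen_of_ne h m hx]

/-- The transvection `v ↦ v w` as an automorphism of `A_Γ`. -/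
noncomputable def transvection (h : lk Γ v ⊆ st Γ w) (hvw : v ≠ w) : MulAut (Artin Γ) :=
  MonoidHom.toMulEquiv (transvectionHom h 1) (transvectionHom h (-1))
    (transvectionHom_comp_eq_id h hvw (neg_add_cancel 1))
    (transvectionHom_comp_eq_id h hvw (add_neg_cancel 1))

theorem transvection_gen_self (h : lk Γ v ⊆ st Γ w) (hvw : v ≠ w) :
    transvection h hvw (gen Γ v) = gen Γ v * gen Γ w :=
  (transvectionHom_gen_self h 1).trans (by rw [zpow_one])

theorem transvection_gen_of_ne {x : V} (h : lk Γ v ⊆ st Γ w) (hvw : v ≠ w) (hx : x ≠ v) :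
    transvection h hvw (gen Γ x) = gen Γ x :=
  transvectionHom_gen_of_ne h 1 hx

theorem outMk_transvection_mem_pureOut (h : lk Γ v ⊆ st Γ w) (hvw : v ≠ w) :
    outMk (transvection h hvw) ∈ pureOut Γ :=
  Subgroup.subset_closure ⟨_, rfl, .inr <| .inl ⟨v, w, hvw, h, transvection_gen_self h hvw,
    fun _ => transvection_gen_of_ne h hvw⟩⟩

theorem special_le_comap_transvectionHom (h : lk Γ v ⊆ st Γ w) (n : ℤ) {Δ : Set V}
    (hΔ : v ∈ Δ → w ∈ Δ) : special Γ Δ ≤ (special Γ Δ).comap (transvectionHom h n) := by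
  refine special_le_iff.2 fun x hx => Subgroup.mem_comap.2 ?_
  rcases eq_or_ne x v with rfl | hxv
  · rw [transvectionHom_gen_self]
    exact mul_mem (gen_mem_special hx) (zpow_mem (gen_mem_special (hΔ hx)) n)
  · rw [transvectionHom_gen_of_ne h n hxv]
    exact gen_mem_special hx

theorem stabilises_transvection_iff (h : lk Γ v ⊆ st Γ w) (hvw : v ≠ w) {Δ : Set V} :
    Stabilises (outMk (transvection h hvw)) (special Γ Δ) ↔ (v ∈ Δ → w ∈ Δ) := by
  constructor
  · intro hstab hv
    by_contra hw
    have hone := hstab.map_eq_one (special_le_ker_exponentSum hw) (gen_mem_special hv)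
    rw [transvection_gen_self, map_mul, exponentSum_gen_of_ne hvw, exponentSum_gen_self,
      one_mul] at hone
    exact one_ne_zero (Multiplicative.ofAdd.injective hone)
  · refine fun hΔ => ⟨_, rfl, le_antisymm ?_ fun a ha => ?_⟩
    · exact Subgroup.map_le_iff_le_comap.2 (special_le_comap_transvectionHom h 1 hΔ)
    · exact ⟨(transvection h hvw).symm a, special_le_comap_transvectionHom h (-1) hΔ ha,
        (transvection h hvw).apply_symm_apply a⟩

theorem actsTrivially_transvection (h : lk Γ v ⊆ st Γ w) (hvw : v ≠ w) {Δ : Set V}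
    (hΔ : v ∉ Δ) : ActsTrivially (outMk (transvection h hvw)) (special Γ Δ) := by
  have hfix : special Γ Δ ≤ (transvection h hvw).toMonoidHom.eqLocus (MonoidHom.id _) :=
    special_le_iff.2 fun _ hx => transvection_gen_of_ne h hvw (ne_of_mem_of_not_mem hx hΔ)
  exact ⟨_, rfl, fun _ hb => hfix hb⟩

end Transvections

section Relative

variable {𝒢 𝒢₁ ℋ : Set (Set V)}

theorem mem_relOut {Φ : Out (Artin Γ)} :
    Φ ∈ relOut Γ 𝒢 ℋ ↔ Φ ∈ pureOut Γ ∧ (∀ Δ ∈ 𝒢, Stabilises Φ (special Γ Δ)) ∧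
      ∀ Δ ∈ ℋ, ActsTrivially Φ (special Γ Δ) := by
  simp only [relOut, Subgroup.mem_inf, Subgroup.mem_iInf, and_assoc]
  rfl

theorem relOut_union_range {ι : Type*} (D : ι → Set V) :
    relOut Γ (𝒢 ∪ Set.range D) ℋ = relOut Γ 𝒢 ℋ ⊓ ⨅ i, stabOut (special Γ (D i)) := by
  simp only [relOut, iInf_union, iInf_range]
  ac_rfl

/-- The family of all special subgroups stabilised by every element of `P`. -/
def stabilisedSets (P : Subgroup (Out (Artin Γ))) : Set (Set V) :=
  {Δ | ∀ Φ ∈ P, Stabilises Φ (special Γ Δ)}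

theorem subset_stabilisedSets_relOut : 𝒢 ⊆ stabilisedSets (relOut Γ 𝒢 ℋ) :=
  fun Δ hΔ _ hΦ => (mem_relOut.1 hΦ).2.1 Δ hΔ

theorem relOut_stabilisedSets :
    relOut Γ (stabilisedSets (relOut Γ 𝒢 ℋ)) ℋ = relOut Γ 𝒢 ℋ := by
  ext Φ
  refine ⟨fun h => ?_, fun h => ?_⟩ <;> obtain ⟨hpure, hstab, htriv⟩ := mem_relOut.1 h
  · exact mem_relOut.2 ⟨hpure, fun Δ hΔ => hstab Δ (subset_stabilisedSets_relOut hΔ), htriv⟩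
  · exact mem_relOut.2 ⟨hpure, fun Δ hΔ => hΔ Φ h, htriv⟩

theorem saturated_stabilisedSets : Saturated Γ (stabilisedSets (relOut Γ 𝒢 ℋ)) ℋ := by
  intro Δ _ hΔ
  rwa [relOut_stabilisedSets] at hΔ

theorem GLe.anti {v w : V} (h𝒢 : 𝒢 ⊆ 𝒢₁) (h : GLe Γ 𝒢₁ v w) : GLe Γ 𝒢 v w :=
  ⟨h.1, fun Δ hΔ => h.2 Δ (h𝒢 hΔ)⟩

theorem Saturated.notMem_of_gLe (hsat : Saturated Γ 𝒢 ℋ) {v w : V} (h : GLe Γ 𝒢 v w)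
    (hvw : v ≠ w) {Δ : Set V} (hΔ : Δ ∈ ℋ) : v ∉ Δ := by
  intro hv
  have hproper : ({v} : Set V) ≠ Set.univ := fun huniv =>
    hvw (huniv.ge (Set.mem_univ w) : w = v).symm
  have hmem : {v} ∈ 𝒢 := hsat _ hproper fun Φ hΦ =>
    ((mem_relOut.1 hΦ).2.2 Δ hΔ).stabilises <|
      special_le_iff.2 fun x (hx : x = v) => gen_mem_special (hx ▸ hv)
  exact hvw (h.2 _ hmem rfl : w = v).symm

theorem outMk_transvection_mem_relOut {v w : V} (h : GLe Γ 𝒢 v w) (hvw : v ≠ w)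
    (hℋ : ∀ Δ ∈ ℋ, v ∉ Δ) : outMk (transvection h.1 hvw) ∈ relOut Γ 𝒢 ℋ :=
  mem_relOut.2 ⟨outMk_transvection_mem_pureOut h.1 hvw,
    fun Δ hΔ => (stabilises_transvection_iff h.1 hvw).2 (h.2 Δ hΔ),
    fun Δ hΔ => actsTrivially_transvection h.1 hvw (hℋ Δ hΔ)⟩

theorem gLe_stabilisedSets_relOut_iff (hsat : Saturated Γ 𝒢 ℋ) (h𝒢 : 𝒢 ⊆ 𝒢₁) {v w : V} :
    GLe Γ (stabilisedSets (relOut Γ 𝒢₁ ℋ)) v w ↔ GLe Γ 𝒢₁ v w := by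
  refine ⟨GLe.anti subset_stabilisedSets_relOut, fun h => ⟨h.1, fun Δ hΔ => ?_⟩⟩
  rcases eq_or_ne v w with rfl | hvw
  · exact id
  · exact (stabilises_transvection_iff h.1 hvw).1 <| hΔ _ <|
      outMk_transvection_mem_relOut h hvw fun _ => hsat.notMem_of_gLe (h.anti h𝒢) hvw

theorem rank_stabilisedSets_relOut (hsat : Saturated Γ 𝒢 ℋ) (h𝒢 : 𝒢 ⊆ 𝒢₁) :
    rank Γ (stabilisedSets (relOut Γ 𝒢₁ ℋ)) = rank Γ 𝒢₁ := by
  have hsetoid : gSetoid Γ (stabilisedSets (relOut Γ 𝒢₁ ℋ)) = gSetoid Γ 𝒢₁ :=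
    Setoid.ext fun _ _ => and_congr (gLe_stabilisedSets_relOut_iff hsat h𝒢)
      (gLe_stabilisedSets_relOut_iff hsat h𝒢)
  rw [rank, rank, Classes, hsetoid]

theorem HasRank.isRelOut {P : Subgroup (Out (Artin Γ))} {m : ℕ} (h : HasRank Γ P m) :
    IsRelOut Γ P :=
  let ⟨⟨𝒢, ℋ, _, hP⟩, _⟩ := h
  ⟨𝒢, ℋ, hP⟩

theorem Saturated.hasRank_relOut (hsat : Saturated Γ 𝒢 ℋ) (h𝒢 : 𝒢 ⊆ 𝒢₁) :
    HasRank Γ (relOut Γ 𝒢₁ ℋ) (rank Γ 𝒢₁) := by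
  refine ⟨⟨_, ℋ, saturated_stabilisedSets, relOut_stabilisedSets.symm⟩, fun 𝒢' ℋ' hsat' hP => ?_⟩
  rw [← rank_stabilisedSets_relOut hsat' subset_rfl, ← hP, rank_stabilisedSets_relOut hsat h𝒢]

end Relative

section Parabolic

variable {𝒢 ℋ : Set (Set V)} (e : ClassOrdering Γ 𝒢)

theorem mk_eq_mk_iff {v w : V} :
    Quotient.mk (gSetoid Γ 𝒢) v = Quotient.mk (gSetoid Γ 𝒢) w ↔
      GLe Γ 𝒢 v w ∧ GLe Γ 𝒢 w v :=
  Quotient.eq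

/-- The class of a vertex together with the vertex's index, from `0`, in the ordering of that class.
The disjoint sum order on these pairs compares vertices of the same class only. -/
def locate (v : V) : Σ _ : Classes Γ 𝒢, ℕ :=
  ⟨Quotient.mk _ v, (e (Quotient.mk _ v)).symm ⟨v, rfl⟩⟩

theorem locate_ordering (c : Classes Γ 𝒢) (i : Fin (Nat.card (classSet Γ 𝒢 c))) :
    locate e (e c i) = ⟨c, i⟩ := by
  obtain ⟨⟨v, rfl⟩, rfl⟩ := (e c).symm.surjective i
  rw [Equiv.apply_symm_apply]
  rfl

theorem mk_mem_range_locate {c : Classes Γ 𝒢} {j : ℕ} (hj : j < Nat.card (classSet Γ 𝒢 c)) :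
    ⟨c, j⟩ ∈ Set.range (locate e) :=
  ⟨e c ⟨j, hj⟩, locate_ordering e c _⟩

theorem card_classSet_pos [Finite V] (c : Classes Γ 𝒢) : 0 < Nat.card (classSet Γ 𝒢 c) := by
  obtain ⟨v, rfl⟩ := Quotient.exists_rep c
  exact Nat.card_pos_iff.2 ⟨⟨v, rfl⟩, inferInstance⟩

theorem mem_parabolicSet_iff_locate_lt {v : V} {c : Classes Γ 𝒢} {j : ℕ}
    (hv : Quotient.mk _ v = c) : v ∈ parabolicSet Γ 𝒢 e c j ↔ locate e v < ⟨c, j⟩ := by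
  subst hv
  rw [locate, Sigma.mk_lt_mk_iff]
  constructor
  · rintro (⟨i, hi, hvi⟩ | ⟨u, hu, -, hvu⟩)
    · rwa [show (⟨v, rfl⟩ : classSet Γ 𝒢 _) = e _ i from Subtype.ext hvi,
        Equiv.symm_apply_apply]
    · exact absurd (mk_eq_mk_iff.1 hu).2 hvu
  · exact fun h => .inl ⟨_, h, by rw [Equiv.apply_symm_apply]⟩

theorem mk_le_locate_iff {v : V} {c : Classes Γ 𝒢} {j : ℕ} :
    ⟨c, j⟩ ≤ locate e v ↔ Quotient.mk _ v = c ∧ v ∉ parabolicSet Γ 𝒢 e c j := by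
  refine ⟨fun h => ?_, fun ⟨hv, hmem⟩ => ?_⟩
  · have hv : Quotient.mk _ v = c := (Sigma.le_def.1 h).1.symm
    exact ⟨hv, fun hmem => ((mem_parabolicSet_iff_locate_lt e hv).1 hmem).not_ge h⟩
  · rw [mem_parabolicSet_iff_locate_lt e hv] at hmem
    subst hv
    rw [locate, Sigma.mk_lt_mk_iff, not_lt] at hmem
    exact Sigma.mk_le_mk_iff.2 hmem

theorem mk_zero_le_locate_iff {v : V} {c : Classes Γ 𝒢} :
    ⟨c, 0⟩ ≤ locate e v ↔ Quotient.mk _ v = c := by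
  refine (mk_le_locate_iff e).trans (and_iff_left_of_imp fun hv hmem => ?_)
  subst hv
  rw [mem_parabolicSet_iff_locate_lt e rfl, locate, Sigma.mk_lt_mk_iff] at hmem
  exact Nat.not_lt_zero _ hmem

theorem mem_parabolicSet_of_gLe {c : Classes Γ 𝒢} {j : ℕ} {v w : V} (hvw : GLe Γ 𝒢 v w)
    (hc : Quotient.mk _ v ≠ c) (hv : v ∈ parabolicSet Γ 𝒢 e c j) :
    w ∈ parabolicSet Γ 𝒢 e c j := by
  rcases hv with ⟨i, -, rfl⟩ | ⟨u, hu, huv, hvu⟩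
  · exact absurd (e c i).2 hc
  · exact .inr ⟨u, hu, huv.trans' Γ hvw, fun hwu => hvu (hvw.trans' Γ hwu)⟩

theorem mk_le_locate_iff_congr {v w : V} (hvw : Quotient.mk (gSetoid Γ 𝒢) v = Quotient.mk _ w)
    {c : Classes Γ 𝒢} {j : ℕ} :
    (⟨c, j⟩ ≤ locate e v ↔ ⟨c, j⟩ ≤ locate e w) ↔
      (v ∈ parabolicSet Γ 𝒢 e c j ↔ w ∈ parabolicSet Γ 𝒢 e c j) := by
  rw [mk_le_locate_iff, mk_le_locate_iff, ← hvw, and_congr_right_iff, not_iff_not]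
  refine ⟨fun h => ?_, fun h _ => h⟩
  by_cases hc : Quotient.mk _ v = c
  · exact h hc
  · obtain ⟨hle, hge⟩ := mk_eq_mk_iff.1 hvw
    exact ⟨mem_parabolicSet_of_gLe e hle hc, mem_parabolicSet_of_gLe e hge (hvw ▸ hc)⟩

theorem gLe_union_range_iff {ι : Type*} {D : ι → Set V} {v w : V} :
    GLe Γ (𝒢 ∪ Set.range D) v w ↔ GLe Γ 𝒢 v w ∧ ∀ i, v ∈ D i → w ∈ D i := by
  simp only [GLe, Set.mem_union, or_imp, forall_and, Set.forall_mem_range, and_assoc]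

theorem mk_union_range_eq_mk_iff {ι : Type*} {D : ι → Set V} {v w : V} :
    Quotient.mk (gSetoid Γ (𝒢 ∪ Set.range D)) v = Quotient.mk _ w ↔
      Quotient.mk (gSetoid Γ 𝒢) v = Quotient.mk _ w ∧ ∀ i, v ∈ D i ↔ w ∈ D i := by
  rw [mk_eq_mk_iff, mk_eq_mk_iff, gLe_union_range_iff, gLe_union_range_iff, and_and_and_comm,
    ← forall_and]
  simp only [iff_def]

theorem gSetoid_union_range_parabolicSet {ι : Type*} (s : ι → Σ _ : Classes Γ 𝒢, ℕ) :
    gSetoid Γ (𝒢 ∪ Set.range fun i => parabolicSet Γ 𝒢 e (s i).1 (s i).2) =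
      Setoid.ker fun v => blockStarts s ∩ Set.Iic (locate e v) := by
  refine Setoid.ext fun v w => Quotient.eq.symm.trans ?_
  have hblocks : blockStarts s ∩ Set.Iic (locate e v) = blockStarts s ∩ Set.Iic (locate e w) ↔
      (∀ c : Classes Γ 𝒢, Quotient.mk _ v = c ↔ Quotient.mk _ w = c) ∧
        ∀ i, s i ≤ locate e v ↔ s i ≤ locate e w := by
    simp only [Set.ext_iff, Set.mem_inter_iff, Set.mem_Iic, and_congr_right_iff, blockStarts,
      Set.mem_union, or_imp, forall_and, Set.forall_mem_range, mk_zero_le_locate_iff]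
  rw [mk_union_range_eq_mk_iff, Setoid.ker_def, hblocks]
  constructor
  · rintro ⟨hvw, hmem⟩
    exact ⟨fun c => by rw [hvw], fun i => (mk_le_locate_iff_congr e hvw).2 (hmem i)⟩
  · rintro ⟨hclass, hcut⟩
    have hvw := ((hclass _).1 rfl).symm
    exact ⟨hvw, fun i => (mk_le_locate_iff_congr e hvw).1 (hcut i)⟩

theorem card_classes_union_range_parabolicSet [Finite V] {ι : Type*} [Finite ι]
    {s : ι → Σ _ : Classes Γ 𝒢, ℕ} (hs : Function.Injective s) (hpos : ∀ i, 0 < (s i).2)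
    (hlt : ∀ i, (s i).2 < Nat.card (classSet Γ 𝒢 (s i).1)) :
    Nat.card (Classes Γ (𝒢 ∪ Set.range fun i => parabolicSet Γ 𝒢 e (s i).1 (s i).2)) =
      Nat.card (Classes Γ 𝒢) + Nat.card ι := by
  have hrange : blockStarts s ⊆ Set.range (locate e) := by
    rintro _ (⟨c, rfl⟩ | ⟨i, rfl⟩)
    · exact mk_mem_range_locate e (card_classSet_pos c)
    · exact mk_mem_range_locate e (hlt i)
  rw [Classes, gSetoid_union_range_parabolicSet, card_quotient_ker_inter_Iic hrange fun _ =>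
    exists_isGreatest_blockStarts_inter_Iic s _, ncard_blockStarts hs hpos]

theorem card_classes_le_card [Finite V] : Nat.card (Classes Γ 𝒢) ≤ Nat.card V :=
  Nat.card_le_card_of_surjective _ Quotient.mk_surjective

theorem iInf_stabIn_relOut {ι : Type*} [Nonempty ι] (D : ι → Set V) :
    ⨅ i, stabIn Γ (relOut Γ 𝒢 ℋ) (D i) = relOut Γ (𝒢 ∪ Set.range D) ℋ := by
  rw [relOut_union_range, inf_iInf]
  rfl

theorem hasRank_iInf_maxParabolics [Finite V] {ι : Type*} [Finite ι] [Nonempty ι]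
    (hsat : Saturated Γ 𝒢 ℋ) {Q : ι → Subgroup (Out (Artin Γ))} (hQ : Function.Injective Q)
    (hmem : ∀ i, Q i ∈ maxParabolics Γ 𝒢 ℋ e) :
    Nat.card ι ≤ rank Γ 𝒢 ∧ HasRank Γ (⨅ i, Q i) (rank Γ 𝒢 - Nat.card ι) := by
  choose c j hpos hlt hQeq using hmem
  let s : ι → Σ _ : Classes Γ 𝒢, ℕ := fun i => ⟨c i, j i⟩
  have hs : Function.Injective s := fun i i' h => hQ <| by
    rw [hQeq, hQeq, show c i = c i' from congrArg Sigma.fst h,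
      show j i = j i' from congrArg Sigma.snd h]
  have hcard := card_classes_union_range_parabolicSet e hs hpos hlt
  have hrank : rank Γ (𝒢 ∪ Set.range fun i => parabolicSet Γ 𝒢 e (c i) (j i)) =
      rank Γ 𝒢 - Nat.card ι := by
    rw [rank, rank, hcard, Nat.sub_sub]
  refine ⟨Nat.le_sub_of_add_le' (hcard ▸ card_classes_le_card), ?_⟩
  rw [iInf_congr hQeq, iInf_stabIn_relOut, ← hrank]
  exact hsat.hasRank_relOut Set.subset_union_left

end Parabolic

end RAAG

theorem mainTheorem9 {V : Type*} [Finite V] (Γ : SimpleGraph V) (𝒢 ℋ : Set (Set V))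
    (hsat : RAAG.Saturated Γ 𝒢 ℋ) (e : RAAG.ClassOrdering Γ 𝒢) :
    (∀ m : ℕ, 1 ≤ m → m < RAAG.rank Γ 𝒢 → ∀ P ∈ RAAG.parabolics Γ 𝒢 ℋ e m,
      RAAG.IsRelOut Γ P ∧ RAAG.HasRank Γ P m) ∧
    (∀ P ∈ RAAG.maxParabolics Γ 𝒢 ℋ e,
      RAAG.IsRelOut Γ P ∧ 1 ≤ RAAG.rank Γ 𝒢 ∧ RAAG.HasRank Γ P (RAAG.rank Γ 𝒢 - 1)) := by
  constructor
  · rintro m - hm P ⟨Q, hQ, hmem, rfl⟩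
    have : Nonempty (Fin (RAAG.rank Γ 𝒢 - m)) := ⟨⟨0, Nat.sub_pos_of_lt hm⟩⟩
    obtain ⟨-, hrank⟩ := RAAG.hasRank_iInf_maxParabolics e hsat hQ hmem
    rw [Nat.card_fin, Nat.sub_sub_self hm.le] at hrank
    exact ⟨hrank.isRelOut, hrank⟩
  · intro P hP
    obtain ⟨hle, hrank⟩ := RAAG.hasRank_iInf_maxParabolics e hsat
      (Function.injective_of_subsingleton fun _ : Unit => P) fun _ => hP
    rw [Nat.card_unique] at hle hrank
    rw [iInf_const] at hrank
    exact ⟨hrank.isRelOut, hle, hrank⟩
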